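/- For $\alpha\in(0,2]$, $c>0$ and $x\in(0,\pi)$, the series $$G_{\alpha,c}(x)=\frac1{2\pi}\sum_{n\in\mathbb Z}\frac{\cos(nx)}{c+|n|^\alpha}$$ converges (as the limit of its symmetric partial sums over $-N\le n\le N$). Let $\{\sigma_t,\ t\ge0\}$ be an $(\alpha/2)$-stable subordinator, that is, the increasing Lévy process on $\mathbb R^+$ with $\mathbb E[e^{-\lambda\sigma_t}]=e^{-t\lambda^{\alpha/2}}$ for all $t,\lambda\ge0$, let $\tau_c$ be an exponential random variable with density $ce^{-ct}$ on $\mathbb R^+$, independent of the process $\sigma$, and set $X=\sigma_{\tau_c}$. Then, for every $x\in(0,\pi)$, the infinite product below converges almost surely, is integrable, and $$G_{\alpha,c}(x)=\frac1{2\pi c}\,\mathbb E\Bigl[\prod_{n\ge0}\bigl(1+2\cos(x)\,e^{-(2n+1)X}+e^{-(4n+2)X}\bigr)\bigl(1-e^{-(2n+2)X}\bigr)\Bigr].$$ Moreover, for all $\alpha\in(0,2]$ and $c>0$, the function $G_{\alpha,c}$ is positive and strictly decreasing on $(0,\pi)$. -/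

import Mathlib

open MeasureTheory ProbabilityTheory Set Filter Topology
open scoped NNReal

noncomputable section

/-- The general term `cos (n x) / (c + |n|^α)`, `n ∈ ℤ`, of the trigonometric series of the
periodic Green function. -/
def greenTerm (α c x : ℝ) (n : ℤ) : ℝ :=
  Real.cos (n * x) / (c + |(n : ℝ)| ^ α)

/-- The periodic Green function
`G_{α,c}(x) = (1 / 2π) ∑_{n ∈ ℤ} cos (n x) / (c + |n|^α)`.
For `α ≤ 1` the series converges only conditionally; as usual for trigonometric series, the sum
over `ℤ` is the limit of the symmetric partial sums over `-N ≤ n ≤ N`. -/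
def greenG (α c x : ℝ) : ℝ :=
  1 / (2 * Real.pi) * ∑'[SummationFilter.symmetricIcc ℤ] n : ℤ, greenTerm α c x n

/-- The factor `(1 + 2 cos x e^{-(2n+1)r} + e^{-(4n+2)r}) (1 - e^{-(2n+2)r})` of the Jacobi triple
product with nome `e^{-r}`. -/
def jacobiFactor (x r : ℝ) (n : ℕ) : ℝ :=
  (1 + 2 * Real.cos x * Real.exp (-((2 * n + 1) * r)) + Real.exp (-((4 * n + 2) * r))) *
    (1 - Real.exp (-((2 * n + 2) * r)))

/-- The Jacobi triple product with nome `e^{-r}` at the point `x`. -/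
def jacobiProduct (x r : ℝ) : ℝ :=
  ∏' n : ℕ, jacobiFactor x r n

/-- `σ` is a (standard) `β`-stable subordinator: an almost surely increasing, right-continuous
process started at `0` (left limits then exist automatically), with independent and stationary
increments, and with Laplace transform `E[e^{-l σ_t}] = e^{-t l^β}`. -/
structure IsStableSubordinator {Ω : Type*} [MeasurableSpace Ω] (β : ℝ)
    (σ : ℝ≥0 → Ω → ℝ) (P : Measure Ω) : Prop where
  measurable : ∀ t, Measurable (σ t)
  zero : ∀ᵐ ω ∂P, σ 0 ω = 0
  monotone : ∀ᵐ ω ∂P, Monotone fun t ↦ σ t ω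
  rightContinuous : ∀ᵐ ω ∂P, ∀ t, ContinuousWithinAt (fun s ↦ σ s ω) (Ici t) t
  indepIncrements : HasIndepIncrements σ P
  stationaryIncrements : ∀ s h, IdentDistrib (fun ω ↦ σ (s + h) ω - σ s ω) (σ h) P P
  laplace : ∀ (t : ℝ≥0) (l : ℝ), 0 ≤ l →
    ∫ ω, Real.exp (-(l * σ t ω)) ∂P = Real.exp (-((t : ℝ) * l ^ β))

end

/-! By the Jacobi triple product, `jacobiProduct x r` is the theta series `∑ e^{-n² r} cos (n x)`.
If `X` is positive with `E[e^{-l X}] = K / (c + l ^ (α / 2))`, then taking `l = n²` and integrating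
termwise turns theta into `K` times the Green series. The interchange cannot rest on absolute
convergence when `α ≤ 1`. Instead, `e^{-n² r}` decreases in `|n|`, so summation by parts bounds
every symmetric partial sum by `1 / sin (x / 2)`, uniformly in `r`; dominated convergence then gives
both the convergence of the series and its value (`integrable_jacobiProduct_and_hasSum`).

Positivity and monotonicity are read off the product: every factor is positive and strictly
increasing in `cos x`, and integration against a nonzero measure keeps strict inequalities.

Two measures supply the Laplace transform. For the stopped subordinator, one conditions on the
exponential time (`IsStableSubordinator.integral_exp_comp`). The last two claims presuppose no
process, so a finite measure with transform `1 / (c + l ^ β)` is built directly: a contour integral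
shows this to be a Stieltjes function, hence a double Laplace transform (`exists_measure_laplace`).
-/

/-! ### Finite and infinite Jacobi triple product -/

/-- The finite `q`-Pochhammer symbol `(t; t)_m = ∏_{k = 1}^m (1 - t ^ k)`. -/
def qPoch (t : ℝ) (m : ℕ) : ℝ := ∏ k ∈ Finset.range m, (1 - t ^ (k + 1))

/-- The inverse `1 / (t; t)_m`, extended by `0` to negative integers. -/
noncomputable def qPochInv (t : ℝ) (m : ℤ) : ℝ := if m < 0 then 0 else (qPoch t m.toNat)⁻¹

lemma qPoch_pos {t : ℝ} (h0 : 0 ≤ t) (h1 : t < 1) (m : ℕ) : 0 < qPoch t m :=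
  Finset.prod_pos fun k _ ↦ sub_pos.2 (pow_lt_one₀ h0 h1 k.succ_ne_zero)

lemma qPoch_succ (t : ℝ) (m : ℕ) : qPoch t (m + 1) = qPoch t m * (1 - t ^ (m + 1)) :=
  Finset.prod_range_succ _ _

lemma qPochInv_natCast (t : ℝ) (m : ℕ) : qPochInv t m = (qPoch t m)⁻¹ := by
  simp [qPochInv]

lemma qPochInv_of_neg (t : ℝ) {m : ℤ} (hm : m < 0) : qPochInv t m = 0 := by
  simp [qPochInv, hm]

/-- The extension by `0` is consistent with the recursion: at `m = 0` the factor `1 - t ^ 0`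
vanishes. Hence no boundary cases arise below at `n = ±N`. -/
lemma qPochInv_sub_one {t : ℝ} (h0 : 0 ≤ t) (h1 : t < 1) (m : ℤ) :
    qPochInv t (m - 1) = (1 - t ^ m) * qPochInv t m := by
  rcases lt_trichotomy m 0 with hm | rfl | hm
  · rw [qPochInv_of_neg t hm, qPochInv_of_neg t (by lia), mul_zero]
  · simp [qPochInv]
  · obtain ⟨k, rfl⟩ : ∃ k : ℕ, m = k + 1 := ⟨(m - 1).toNat, by lia⟩
    have h := (qPoch_pos h0 h1 (k + 1)).ne'
    rw [add_sub_cancel_right, qPochInv_natCast]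
    have : qPochInv t ((k : ℤ) + 1) = (qPoch t (k + 1))⁻¹ := by
      exact_mod_cast qPochInv_natCast t (k + 1)
    rw [this]
    rw [qPoch_succ] at h ⊢
    have h2 := right_ne_zero_of_mul h
    have h3 := left_ne_zero_of_mul h
    have h4 : t ^ ((k : ℤ) + 1) = t ^ (k + 1) := by exact_mod_cast zpow_natCast t (k + 1)
    rw [h4]
    field_simp

/-- The coefficients of the finite form of the Jacobi triple product. -/
noncomputable def tripleCoeff (q : ℝ) (N : ℕ) (n : ℤ) : ℝ :=
  q ^ (n ^ 2) * (qPoch (q ^ 2) (2 * N) * (qPochInv (q ^ 2) (N - n) * qPochInv (q ^ 2) (N + n)))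

/-- This is the effect on Laurent coefficients of multiplying by `1 + (z + z⁻¹) q^(2N+1) +
q^(4N+2)`. All terms are written through `A`, `B` and the powers `a`, `b` of `q ^ 2`; since `a * b =
q ^ (4N+4)`, what remains is a rational identity in `a`, `b`, `q`. -/
lemma tripleCoeff_succ {q : ℝ} (h0 : 0 < q) (h1 : q < 1) (N : ℕ) (n : ℤ) :
    tripleCoeff q (N + 1) n = (1 + q ^ (4 * N + 2)) * tripleCoeff q N n +
      q ^ (2 * N + 1) * (tripleCoeff q N (n - 1) + tripleCoeff q N (n + 1)) := by
  have ht0 : 0 ≤ q ^ 2 := by positivity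
  have ht1 : q ^ 2 < 1 := by nlinarith
  have hq : q ≠ 0 := h0.ne'
  set A := qPochInv (q ^ 2) (N + 1 - n) with hA
  set B := qPochInv (q ^ 2) (N + 1 + n) with hB
  set a := (q ^ 2) ^ ((N : ℤ) + 1 - n) with ha
  set b := (q ^ 2) ^ ((N : ℤ) + 1 + n) with hb
  have eA1 : qPochInv (q ^ 2) (N - n) = (1 - a) * A := by
    rw [ha, hA, ← qPochInv_sub_one ht0 ht1]; congr 1; ring
  have eB1 : qPochInv (q ^ 2) (N + n) = (1 - b) * B := by
    rw [hb, hB, ← qPochInv_sub_one ht0 ht1]; congr 1; ring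
  have eA2 : qPochInv (q ^ 2) (N - (n + 1)) = (1 - a / q ^ 2) * ((1 - a) * A) := by
    rw [← eA1, ha, show ((N : ℤ) - (n + 1)) = (N - n) - 1 by ring, qPochInv_sub_one ht0 ht1,
      show (N : ℤ) + 1 - n = (N - n) + 1 by ring, zpow_add_one₀ (by positivity),
      mul_div_cancel_right₀ _ (by positivity)]
  have eB2 : qPochInv (q ^ 2) (N + (n - 1)) = (1 - b / q ^ 2) * ((1 - b) * B) := by
    rw [← eB1, hb, show ((N : ℤ) + (n - 1)) = (N + n) - 1 by ring, qPochInv_sub_one ht0 ht1,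
      show (N : ℤ) + 1 + n = (N + n) + 1 by ring, zpow_add_one₀ (by positivity),
      mul_div_cancel_right₀ _ (by positivity)]
  have eA3 : qPochInv (q ^ 2) (N - (n - 1)) = A := by rw [hA]; congr 1; ring
  have eB3 : qPochInv (q ^ 2) (N + (n + 1)) = B := by rw [hB]; congr 1; ring
  have ea : q ^ (2 * N + 1) * q ^ ((n - 1) ^ 2) = q ^ (n ^ 2) * a := by
    rw [ha, ← zpow_natCast q 2, ← zpow_natCast q (2 * N + 1), ← zpow_mul, ← zpow_add₀ hq,
      ← zpow_add₀ hq]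
    congr 1; push_cast; ring
  have eb : q ^ (2 * N + 1) * q ^ ((n + 1) ^ 2) = q ^ (n ^ 2) * b := by
    rw [hb, ← zpow_natCast q 2, ← zpow_natCast q (2 * N + 1), ← zpow_mul, ← zpow_add₀ hq,
      ← zpow_add₀ hq]
    congr 1; push_cast; ring
  have eab : a * b = q ^ (4 * N + 4) := by
    rw [ha, hb, ← zpow_add₀ (by positivity), ← zpow_natCast q 2, ← zpow_natCast q (4 * N + 4),
      ← zpow_mul]
    congr 1; push_cast; ring
  have e1 : q ^ (4 * N + 2) = a * b / q ^ 2 := by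
    rw [eab, eq_div_iff (by positivity), ← pow_add]
  have e2 : qPoch (q ^ 2) (2 * (N + 1)) = qPoch (q ^ 2) (2 * N) * (1 - a * b / q ^ 2) *
      (1 - a * b) := by
    rw [show 2 * (N + 1) = 2 * N + 1 + 1 by ring, qPoch_succ, qPoch_succ, ← e1, eab]
    congr 2 <;> ring
  rw [mul_add, tripleCoeff, tripleCoeff, tripleCoeff, tripleCoeff, ← mul_assoc (q ^ (2 * N + 1)),
    ← mul_assoc (q ^ (2 * N + 1)), ea, eb, eA1, eB1, eA2, eB2, eA3, eB3, e1, e2]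
  push_cast
  rw [← hA, ← hB]
  field_simp
  ring

/-- Summing over all of `ℤ`, although only finitely many coefficients are nonzero, makes
multiplication by `z` and `z⁻¹` a mere reindexing. -/
lemma hasSum_tripleCoeff {q : ℝ} (h0 : 0 < q) (h1 : q < 1) {z : ℂ} (hz : z ≠ 0) (N : ℕ) :
    HasSum (fun n : ℤ ↦ (tripleCoeff q N n : ℂ) * z ^ n)
      (∏ k ∈ Finset.range N, (1 + (z + z⁻¹) * q ^ (2 * k + 1) + q ^ (4 * k + 2))) := by
  induction N with
  | zero =>
    have : HasSum (fun n : ℤ ↦ (tripleCoeff q 0 n : ℂ) * z ^ n)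
        ((tripleCoeff q 0 0 : ℂ) * z ^ (0 : ℤ)) := by
      refine hasSum_single 0 fun n hn ↦ ?_
      rcases lt_or_gt_of_ne hn with h | h
      · simp [tripleCoeff, qPochInv_of_neg _ h]
      · simp [tripleCoeff, qPochInv_of_neg _ (neg_lt_zero.2 h)]
    simpa [tripleCoeff, qPochInv, qPoch] using this
  | succ N ih =>
    have h2 := ((Equiv.subRight (1 : ℤ)).hasSum_iff.2 ih).mul_left ((q : ℂ) ^ (2 * N + 1) * z)
    have h3 := ((Equiv.addRight (1 : ℤ)).hasSum_iff.2 ih).mul_left ((q : ℂ) ^ (2 * N + 1) * z⁻¹)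
    have h := (ih.mul_left (1 + (q : ℂ) ^ (4 * N + 2))).add (h2.add h3)
    rw [Finset.prod_range_succ]
    convert! h using 1
    · ext n
      simp only [Function.comp, Equiv.subRight_apply, Equiv.coe_addRight]
      rw [tripleCoeff_succ h0 h1, zpow_sub_one₀ hz, zpow_add_one₀ hz]
      push_cast
      field_simp
    · ring

lemma qPoch_antitone {t : ℝ} (h0 : 0 ≤ t) (h1 : t < 1) : Antitone (qPoch t) := by
  refine antitone_nat_of_succ_le fun m ↦ ?_
  rw [qPoch_succ]
  exact mul_le_of_le_one_right (qPoch_pos h0 h1 m).le (by have := pow_nonneg h0 (m + 1); linarith)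

/-- Positivity of the limit is the point: it bounds the inverse symbols uniformly. -/
lemma exists_tendsto_qPoch {t : ℝ} (h0 : 0 ≤ t) (h1 : t < 1) :
    ∃ L, 0 < L ∧ Tendsto (qPoch t) atTop (𝓝 L) := by
  have hs : Summable fun k : ℕ ↦ -t ^ (k + 1) :=
    ((summable_nat_add_iff 1).2 (summable_geometric_of_lt_one h0 h1)).neg
  have hl := Real.summable_log_one_add_of_summable hs
  have hp : ∀ k : ℕ, 0 < 1 + -t ^ (k + 1) := fun k ↦ by
    have := pow_lt_one₀ h0 h1 k.succ_ne_zero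
    rw [Nat.succ_eq_add_one] at this
    linarith
  refine ⟨∏' k : ℕ, (1 + -t ^ (k + 1)), ?_, ?_⟩
  · rw [← Real.rexp_tsum_eq_tprod hp hl]; exact Real.exp_pos _
  · refine (Real.multipliable_one_add_of_summable hs).tendsto_prod_tprod_nat.congr fun N ↦ ?_
    simp only [qPoch, sub_eq_add_neg]

lemma summable_zpow_sq {q : ℝ} (h0 : 0 < q) (h1 : q < 1) :
    Summable fun n : ℤ ↦ q ^ (n ^ 2) := by
  have h : Summable fun n : ℕ ↦ q ^ ((n : ℤ) ^ 2) := by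
    refine (summable_geometric_of_lt_one h0.le h1).of_nonneg_of_le (fun n ↦ by positivity)
      fun n ↦ ?_
    rw [← Nat.cast_pow, zpow_natCast]
    exact pow_le_pow_of_le_one h0.le h1.le (Nat.le_self_pow two_ne_zero n)
  exact Summable.of_nat_of_neg h (by simpa using h)

/-- The **Jacobi triple product** identity, in the form of a limit of finite products. -/
theorem tendsto_tripleProduct {q : ℝ} (h0 : 0 < q) (h1 : q < 1) {z : ℂ} (hz : ‖z‖ = 1) :
    Tendsto (fun N ↦ ∏ k ∈ Finset.range N, ((1 + (z + z⁻¹) * q ^ (2 * k + 1) + q ^ (4 * k + 2)) *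
      (1 - (q : ℂ) ^ (2 * k + 2)))) atTop (𝓝 (∑' n : ℤ, (q : ℂ) ^ (n ^ 2) * z ^ n)) := by
  have ht0 : 0 ≤ q ^ 2 := by positivity
  have ht1 : q ^ 2 < 1 := by nlinarith
  have hz0 : z ≠ 0 := by rintro rfl; simp at hz
  obtain ⟨L, hL, hlim⟩ := exists_tendsto_qPoch ht0 ht1
  have hge (m : ℕ) : L ≤ qPoch (q ^ 2) m := (qPoch_antitone ht0 ht1).le_of_tendsto hlim m
  have hle (m : ℕ) : qPoch (q ^ 2) m ≤ 1 := by
    simpa [qPoch] using qPoch_antitone ht0 ht1 (Nat.zero_le m)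
  have hinv (m : ℤ) : 0 ≤ qPochInv (q ^ 2) m ∧ qPochInv (q ^ 2) m ≤ L⁻¹ := by
    rcases lt_or_ge m 0 with hm | hm
    · rw [qPochInv_of_neg _ hm]; exact ⟨le_rfl, by positivity⟩
    · lift m to ℕ using hm
      rw [qPochInv_natCast]
      exact ⟨(inv_pos.2 (qPoch_pos ht0 ht1 m)).le, inv_anti₀ hL (hge m)⟩
  have hinvlim : Tendsto (qPochInv (q ^ 2)) atTop (𝓝 L⁻¹) := by
    refine ((hlim.comp (tendsto_atTop_atTop.2 fun b ↦ ⟨b, fun a h ↦ by lia⟩ : Tendsto Int.toNat atTop atTop)).inv₀ hL.ne').congr' ?_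
    filter_upwards [eventually_ge_atTop 0] with m hm
    simp [qPochInv, hm.not_gt]
  have key (N : ℕ) : ∏ k ∈ Finset.range N, ((1 + (z + z⁻¹) * q ^ (2 * k + 1) + q ^ (4 * k + 2)) *
      (1 - (q : ℂ) ^ (2 * k + 2))) =
      ∑' n : ℤ, ((qPoch (q ^ 2) N * tripleCoeff q N n : ℝ) : ℂ) * z ^ n := by
    rw [Finset.prod_mul_distrib]
    have h2 : ∏ k ∈ Finset.range N, (1 - (q : ℂ) ^ (2 * k + 2)) = (qPoch (q ^ 2) N : ℂ) := by
      rw [qPoch]; push_cast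
      refine Finset.prod_congr rfl fun k _ ↦ ?_
      rw [← pow_mul]; congr 2
    rw [h2, mul_comm, ← ((hasSum_tripleCoeff h0 h1 hz0 N).mul_left _).tsum_eq]
    refine tsum_congr fun n ↦ ?_
    push_cast; ring
  simp_rw [key]
  -- The coefficient of `z ^ n` tends to `q ^ (n ^ 2) * (L * L) / (L * L)`; every Pochhammer symbol
  -- being at most `1` and every inverse at most `L⁻¹`, it is dominated by `q ^ (n ^ 2) / L ^ 2`.
  refine tendsto_tsum_of_dominated_convergence (bound := fun n : ℤ ↦ q ^ (n ^ 2) * (L⁻¹ * L⁻¹))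
    ((summable_zpow_sq h0 h1).mul_right _) (fun n ↦ ?_) (Eventually.of_forall fun N n ↦ ?_)
  · refine Tendsto.mul_const _ ?_
    rw [← Complex.ofReal_zpow]
    refine (Complex.continuous_ofReal.tendsto _).comp ?_
    have e1 : Tendsto (fun N : ℕ ↦ qPochInv (q ^ 2) (N - n)) atTop (𝓝 L⁻¹) :=
      hinvlim.comp (tendsto_atTop_add_const_right _ _ tendsto_natCast_atTop_atTop)
    have e2 : Tendsto (fun N : ℕ ↦ qPochInv (q ^ 2) (N + n)) atTop (𝓝 L⁻¹) :=
      hinvlim.comp (tendsto_atTop_add_const_right _ _ tendsto_natCast_atTop_atTop)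
    have e3 : Tendsto (fun N : ℕ ↦ qPoch (q ^ 2) (2 * N)) atTop (𝓝 L) :=
      hlim.comp (tendsto_id.const_mul_atTop' two_pos)
    have := hlim.mul ((e3.mul (e1.mul e2)).const_mul (q ^ (n ^ 2)))
    have hLL : L * (q ^ (n ^ 2) * (L * (L⁻¹ * L⁻¹))) = q ^ (n ^ 2) := by field_simp
    rwa [hLL] at this
  · rw [norm_mul, norm_zpow, hz, one_zpow, mul_one, Complex.norm_real, tripleCoeff]
    have a1 := hinv (N - n)
    have a2 := hinv (N + n)
    have p1 := (qPoch_pos ht0 ht1 N).le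
    have p2 := (qPoch_pos ht0 ht1 (2 * N)).le
    have hm : 0 ≤ q ^ (n ^ 2) := by positivity
    have h3 : qPochInv (q ^ 2) (N - n) * qPochInv (q ^ 2) (N + n) ≤ L⁻¹ * L⁻¹ :=
      mul_le_mul a1.2 a2.2 a2.1 (by positivity)
    have h4 : 0 ≤ qPochInv (q ^ 2) (N - n) * qPochInv (q ^ 2) (N + n) := mul_nonneg a1.1 a2.1
    rw [Real.norm_of_nonneg (by positivity)]
    calc _ ≤ 1 * (q ^ n ^ 2 * (1 * (L⁻¹ * L⁻¹))) := by
          gcongr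
          · exact hle _
          · exact hle _
      _ = _ := by ring

/-! ### Convergence, positivity and monotonicity of the Jacobi product -/

section JacobiFactor

variable {r : ℝ}

lemma summable_exp_neg_linear {a b : ℕ} (ha : 0 < a) (hr : 0 < r) :
    Summable fun n : ℕ ↦ Real.exp (-((a * n + b) * r)) := by
  have h : Summable fun n : ℕ ↦ Real.exp (-(b * r)) * Real.exp (-(a * r)) ^ n :=
    (summable_geometric_of_lt_one (Real.exp_pos _).le
      (Real.exp_lt_one_iff.2 (neg_lt_zero.2 (by positivity)))).mul_left _
  refine h.congr fun n ↦ ?_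
  rw [← Real.exp_nat_mul, ← Real.exp_add]
  congr 1; ring

lemma jacobiFactor_eq (x r : ℝ) (n : ℕ) : jacobiFactor x r n =
    (1 + 2 * Real.cos x * Real.exp (-r) ^ (2 * n + 1) + Real.exp (-r) ^ (4 * n + 2)) *
      (1 - Real.exp (-r) ^ (2 * n + 2)) := by
  simp only [jacobiFactor, ← Real.exp_nat_mul]
  congr! 3 <;> · push_cast; ring_nf

lemma summable_jacobiFactor_sub_one (x : ℝ) (hr : 0 < r) :
    Summable fun n ↦ jacobiFactor x r n - 1 := by
  have h1 := summable_exp_neg_linear (a := 2) (b := 1) two_pos hr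
  have h2 := summable_exp_neg_linear (a := 4) (b := 2) four_pos hr
  have h3 := summable_exp_neg_linear (a := 2) (b := 2) two_pos hr
  -- With `A` the summand here, the factor minus `1` is `A - (1 + A) e^{-(2n+2)r}`, and `|1 + A| ≤
  -- 4`.
  have hA := (h1.mul_left (2 * Real.cos x)).add h2
  have hB : Summable fun n : ℕ ↦ (1 + (2 * Real.cos x * Real.exp (-(((2 : ℕ) * n + (1 : ℕ)) * r)) +
      Real.exp (-(((4 : ℕ) * n + (2 : ℕ)) * r)))) * Real.exp (-(((2 : ℕ) * n + (2 : ℕ)) * r)) := by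
    refine Summable.of_norm_bounded (h3.mul_left 4) fun n ↦ ?_
    rw [norm_mul, Real.norm_of_nonneg (Real.exp_pos _).le]
    gcongr
    have e1 : Real.exp (-(((2 : ℕ) * n + (1 : ℕ)) * r)) ≤ 1 := Real.exp_le_one_iff.2 (by simp; positivity)
    have e2 : Real.exp (-(((4 : ℕ) * n + (2 : ℕ)) * r)) ≤ 1 := Real.exp_le_one_iff.2 (by simp; positivity)
    have e3 := Real.exp_pos (-(((2 : ℕ) * n + (1 : ℕ)) * r))
    have e4 := Real.exp_pos (-(((4 : ℕ) * n + (2 : ℕ)) * r))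
    rw [Real.norm_eq_abs, abs_le]
    constructor <;> nlinarith [Real.neg_one_le_cos x, Real.cos_le_one x]
  refine (hA.sub hB).congr fun n ↦ ?_
  simp only [jacobiFactor]
  push_cast
  ring

lemma multipliable_jacobiFactor (x : ℝ) (hr : 0 < r) : Multipliable (jacobiFactor x r) := by
  simpa using Real.multipliable_one_add_of_summable (summable_jacobiFactor_sub_one x hr)

lemma jacobiFactor_lt (hr : 0 < r) {x y : ℝ} (hxy : Real.cos y < Real.cos x) (n : ℕ) :
    jacobiFactor y r n < jacobiFactor x r n := by
  have : Real.exp (-((2 * n + 2) * r)) < 1 := Real.exp_lt_one_iff.2 (neg_lt_zero.2 (by positivity))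
  unfold jacobiFactor
  gcongr

/-- With `u = e^{-(2n+1)r} < 1`, the first bracket is at least `(1 - u) ^ 2`. -/
lemma jacobiFactor_pos (hr : 0 < r) (x : ℝ) (n : ℕ) : 0 < jacobiFactor x r n := by
  have h2 : Real.exp (-((2 * n + 2) * r)) < 1 := Real.exp_lt_one_iff.2 (neg_lt_zero.2 (by positivity))
  have h1 : Real.exp (-((2 * n + 1) * r)) < 1 := Real.exp_lt_one_iff.2 (neg_lt_zero.2 (by positivity))
  have h0 := Real.exp_pos (-((2 * n + 1) * r))
  have e : Real.exp (-((4 * n + 2) * r)) = Real.exp (-((2 * n + 1) * r)) ^ 2 := by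
    rw [← Real.exp_nat_mul]; congr 1; push_cast; ring
  refine mul_pos ?_ (by linarith)
  rw [e]
  nlinarith [Real.neg_one_le_cos x]

lemma summable_log_jacobiFactor (x : ℝ) (hr : 0 < r) :
    Summable fun n ↦ Real.log (jacobiFactor x r n) := by
  simpa using Real.summable_log_one_add_of_summable (summable_jacobiFactor_sub_one x hr)

lemma jacobiProduct_eq_exp (x : ℝ) (hr : 0 < r) :
    jacobiProduct x r = Real.exp (∑' n, Real.log (jacobiFactor x r n)) :=
  (Real.rexp_tsum_eq_tprod (jacobiFactor_pos hr x) (summable_log_jacobiFactor x hr)).symm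

lemma jacobiProduct_pos (x : ℝ) (hr : 0 < r) : 0 < jacobiProduct x r := by
  rw [jacobiProduct_eq_exp x hr]; exact Real.exp_pos _

/-- Logarithms preserve strictness in the limit: the log series are compared termwise, strictly at
`n = 0`. -/
lemma jacobiProduct_lt (hr : 0 < r) {x y : ℝ} (hxy : Real.cos y < Real.cos x) :
    jacobiProduct y r < jacobiProduct x r := by
  rw [jacobiProduct_eq_exp x hr, jacobiProduct_eq_exp y hr, Real.exp_lt_exp]
  exact Summable.tsum_lt_tsum (i := 0)
    (fun n ↦ (Real.log_lt_log (jacobiFactor_pos hr y n) (jacobiFactor_lt hr hxy n)).le)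
    (Real.log_lt_log (jacobiFactor_pos hr y 0) (jacobiFactor_lt hr hxy 0))
    (summable_log_jacobiFactor y hr) (summable_log_jacobiFactor x hr)

/-- The **Jacobi triple product** identity for the real nome `e^{-r}`. -/
theorem hasSum_jacobiProduct (x : ℝ) (hr : 0 < r) :
    HasSum (fun n : ℤ ↦ Real.exp (-(n ^ 2 * r)) * Real.cos (n * x)) (jacobiProduct x r) := by
  have h0 := Real.exp_pos (-r)
  have h1 : Real.exp (-r) < 1 := Real.exp_lt_one_iff.2 (neg_lt_zero.2 hr)
  have hq (n : ℤ) : Real.exp (-r) ^ (n ^ 2) = Real.exp (-(n ^ 2 * r)) := by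
    rw [← Real.rpow_intCast, ← Real.exp_mul]; congr 1; push_cast; ring
  set z : ℂ := Complex.exp (x * Complex.I) with hzdef
  have hz : ‖z‖ = 1 := Complex.norm_exp_ofReal_mul_I x
  have hzz : z + z⁻¹ = ((2 * Real.cos x : ℝ) : ℂ) := by
    rw [hzdef, ← Complex.exp_neg, ← neg_mul]
    push_cast
    rw [Complex.two_cos]
  have hs : Summable fun n : ℤ ↦ (Real.exp (-r) : ℂ) ^ (n ^ 2) * z ^ n := by
    refine Summable.of_norm ?_
    simpa [hz, norm_zpow, abs_of_pos h0, ← Complex.ofReal_exp] using summable_zpow_sq h0 h1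
  have hlim := tendsto_tripleProduct h0 h1 hz
  have hprod := (Complex.continuous_ofReal.tendsto _).comp
    (multipliable_jacobiFactor x hr).tendsto_prod_tprod_nat
  have heq : ((jacobiProduct x r : ℝ) : ℂ) =
      ∑' n : ℤ, (Real.exp (-r) : ℂ) ^ (n ^ 2) * z ^ n := by
    refine tendsto_nhds_unique hprod (hlim.congr fun N ↦ ?_)
    simp only [Function.comp, Complex.ofReal_prod]
    refine Finset.prod_congr rfl fun k _ ↦ ?_
    rw [jacobiFactor_eq, hzz]
    push_cast
    ring
  have hsum := hs.hasSum
  rw [← heq] at hsum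
  have := Complex.hasSum_re hsum
  rw [Complex.ofReal_re] at this
  refine this.congr_fun fun n ↦ ?_
  rw [← Complex.ofReal_zpow, Complex.re_ofReal_mul, hq, hzdef, ← Complex.exp_int_mul,
    ← mul_assoc]
  congr 1
  have := Complex.exp_ofReal_mul_I_re (n * x)
  push_cast at this
  rw [this]

end JacobiFactor

/-! ### Uniform bounds on symmetric sums and termwise integration -/

/-- Symmetric trigonometric sums with antitone nonnegative coefficients are bounded. -/
lemma abs_sum_Icc_mul_cos_le {a : ℕ → ℝ} (ha : Antitone a) (h0 : ∀ n, 0 ≤ a n) {x : ℝ}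
    (hx : 0 < Real.sin (x / 2)) (N : ℕ) :
    |∑ n ∈ Finset.Icc (-(N : ℤ)) N, a n.natAbs * Real.cos (n * x)| ≤ a 0 / Real.sin (x / 2) := by
  -- Summation by parts as an induction: `2 sin (x/2) cos ((N+1)x)` is a difference of consecutive
  -- values of `sin ((N+1/2)x)`. Each step adds an error of at most `a N - a (N + 1)`, and these
  -- telescope.
  have key : |Real.sin (x / 2) * ∑ n ∈ Finset.Icc (-(N : ℤ)) N, a n.natAbs * Real.cos (n * x) -
      a N * Real.sin ((N + 1 / 2) * x)| ≤ a 0 - a N := by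
    induction N with
    | zero => simp [mul_comm, div_eq_mul_inv]
    | succ N ih =>
      have hI : ∑ n ∈ Finset.Icc (-((N + 1 : ℕ) : ℤ)) (N + 1 : ℕ), a n.natAbs * Real.cos (n * x) =
          ∑ n ∈ Finset.Icc (-(N : ℤ)) N, a n.natAbs * Real.cos (n * x) +
            2 * (a (N + 1) * Real.cos ((N + 1) * x)) := by
        have : Finset.Icc (-((N + 1 : ℕ) : ℤ)) (N + 1 : ℕ) =
            insert (-((N : ℤ) + 1)) (insert ((N : ℤ) + 1) (Finset.Icc (-(N : ℤ)) N)) := by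
          ext k; simp only [Finset.mem_Icc, Finset.mem_insert]; push_cast; lia
        rw [this, Finset.sum_insert (by simp; lia), Finset.sum_insert (by simp)]
        have h1 : (-((N : ℤ) + 1)).natAbs = N + 1 := by lia
        have h2 : ((N : ℤ) + 1).natAbs = N + 1 := by lia
        rw [h1, h2]
        push_cast
        rw [neg_mul, Real.cos_neg]
        ring
      have hs : Real.sin (x / 2) * (2 * Real.cos ((N + 1) * x)) =
          Real.sin ((N + 1 + 1 / 2) * x) - Real.sin ((N + 1 / 2) * x) := by
        rw [Real.sin_sub_sin]; ring_nf
      have hstep : Real.sin (x / 2) * (∑ n ∈ Finset.Icc (-(N : ℤ)) N, a n.natAbs * Real.cos (n * x)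
          + 2 * (a (N + 1) * Real.cos ((N + 1) * x))) - a (N + 1) * Real.sin ((N + 1 + 1 / 2) * x) =
          (Real.sin (x / 2) * ∑ n ∈ Finset.Icc (-(N : ℤ)) N, a n.natAbs * Real.cos (n * x) -
          a N * Real.sin ((N + 1 / 2) * x)) + (a N - a (N + 1)) * Real.sin ((N + 1 / 2) * x) := by
        linear_combination a (N + 1) * hs
      rw [hI]
      push_cast
      rw [hstep]
      refine (abs_add_le _ _).trans ?_
      have hd : 0 ≤ a N - a (N + 1) := sub_nonneg.2 (ha N.le_succ)
      rw [abs_mul, abs_of_nonneg hd]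
      have := mul_le_mul_of_nonneg_left (Real.abs_sin_le_one ((N + 1 / 2) * x)) hd
      linarith
  rw [le_div_iff₀ hx, ← abs_of_pos hx, ← abs_mul, mul_comm]
  have h1 : |a N * Real.sin ((N + 1 / 2) * x)| ≤ a N := by
    rw [abs_mul, abs_of_nonneg (h0 N)]
    exact mul_le_of_le_one_right (h0 N) (Real.abs_sin_le_one _)
  rw [abs_le] at key h1 ⊢
  constructor <;> linarith

lemma sin_half_pos {x : ℝ} (hx : x ∈ Ioo 0 Real.pi) : 0 < Real.sin (x / 2) :=
  Real.sin_pos_of_pos_of_lt_pi (by linarith [hx.1]) (by linarith [hx.1, hx.2])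

/-- If the Laplace transform of `X` interpolates `K / (c + |n| ^ α)` at the squares `n ^ 2`, then
the Green series is represented by the integral of the Jacobi product at `X`. -/
theorem integrable_jacobiProduct_and_hasSum {Ω : Type*} [MeasurableSpace Ω] {μ : Measure Ω}
    [IsFiniteMeasure μ] {X : Ω → ℝ} (hX : AEMeasurable X μ) (hpos : ∀ᵐ ω ∂μ, 0 < X ω)
    {α c K : ℝ} (hK : K ≠ 0)
    (hlap : ∀ n : ℤ, ∫ ω, Real.exp (-(n ^ 2 * X ω)) ∂μ = K / (c + |(n : ℝ)| ^ α))
    {x : ℝ} (hx : x ∈ Ioo 0 Real.pi) :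
    Integrable (fun ω ↦ jacobiProduct x (X ω)) μ ∧
      HasSum (greenTerm α c x) (K⁻¹ * ∫ ω, jacobiProduct x (X ω) ∂μ)
        (SummationFilter.symmetricIcc ℤ) := by
  set F : ℕ → Ω → ℝ := fun N ω ↦
    ∑ n ∈ Finset.Icc (-(N : ℤ)) N, Real.exp (-(n ^ 2 * X ω)) * Real.cos (n * x) with hF
  have hterm (n : ℤ) : AEStronglyMeasurable (fun ω ↦ Real.exp (-(n ^ 2 * X ω))) μ :=
    (Real.measurable_exp.comp_aemeasurable (hX.const_mul _).neg).aestronglyMeasurable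
  -- The bound depends on neither `N` nor `ω`, so a constant dominates, integrable because `μ` is
  -- finite.
  have hbound (N : ℕ) : ∀ᵐ ω ∂μ, ‖F N ω‖ ≤ 1 / Real.sin (x / 2) := by
    filter_upwards [hpos] with ω hω
    have hanti : Antitone fun n : ℕ ↦ Real.exp (-((n : ℝ) ^ 2 * X ω)) := fun m n h ↦ by
      dsimp only; gcongr
    have := abs_sum_Icc_mul_cos_le hanti (fun n ↦ (Real.exp_pos _).le) (sin_half_pos hx) N
    simpa [hF, Nat.cast_natAbs] using this
  have hlim : ∀ᵐ ω ∂μ, Tendsto (fun N ↦ F N ω) atTop (𝓝 (jacobiProduct x (X ω))) := by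
    filter_upwards [hpos] with ω hω
    exact SummationFilter.hasSum_symmetricIcc_iff.1
      ((hasSum_jacobiProduct x hω).mono_left SummationFilter.LeAtTop.le_atTop)
  have hmeas (N : ℕ) : AEStronglyMeasurable (F N) μ := by
    simp only [hF]
    exact Finset.aestronglyMeasurable_fun_sum _ fun n _ ↦ (hterm n).mul_const _
  have hint (n : ℤ) : Integrable (fun ω ↦ Real.exp (-(n ^ 2 * X ω))) μ := by
    refine (integrable_const (1 : ℝ)).mono' (hterm n) ?_
    filter_upwards [hpos] with ω hω
    rw [Real.norm_of_nonneg (Real.exp_pos _).le, Real.exp_le_one_iff]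
    have : 0 ≤ (n : ℝ) ^ 2 * X ω := by positivity
    linarith
  refine ⟨?_, ?_⟩
  · refine (integrable_const (1 / Real.sin (x / 2))).mono'
      (aestronglyMeasurable_of_tendsto_ae atTop hmeas hlim) ?_
    filter_upwards [hlim, ae_all_iff.2 hbound] with ω h1 h2
    exact le_of_tendsto h1.norm (Eventually.of_forall h2)
  · have := (tendsto_integral_of_dominated_convergence _ hmeas
      (integrable_const (1 / Real.sin (x / 2))) hbound hlim).const_mul K⁻¹
    rw [SummationFilter.hasSum_symmetricIcc_iff]
    refine this.congr fun N ↦ ?_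
    simp only [hF]
    rw [integral_finsetSum _ fun n _ ↦ (hint n).mul_const _, Finset.mul_sum]
    refine Finset.sum_congr rfl fun n _ ↦ ?_
    rw [integral_mul_const, hlap, greenTerm]
    field_simp

/-- Strict monotonicity of the integral for almost everywhere strictly ordered functions. -/
lemma integral_lt_integral_of_ae_lt {Ω : Type*} [MeasurableSpace Ω] {μ : Measure Ω} (hμ : μ ≠ 0)
    {f g : Ω → ℝ} (hf : Integrable f μ) (hg : Integrable g μ) (h : ∀ᵐ ω ∂μ, f ω < g ω) :
    ∫ ω, f ω ∂μ < ∫ ω, g ω ∂μ := by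
  rw [← sub_pos, ← integral_sub hg hf, integral_pos_iff_support_of_nonneg_ae
    (h.mono fun ω hω ↦ (sub_pos.2 hω).le) (hg.sub hf), pos_iff_ne_zero]
  intro h0
  have : ∀ᵐ ω ∂μ, False := by
    have h1 : ∀ᵐ ω ∂μ, ω ∉ Function.support fun ω ↦ g ω - f ω := measure_eq_zero_iff_ae_notMem.1 h0
    filter_upwards [h, h1] with ω h2 h3
    exact h3 (sub_pos.2 h2).ne'
  exact hμ (by simpa using this)

/-! ### The Stieltjes representation of `1 / (c + l ^ β)` -/

section Stieltjes

variable {β c : ℝ}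

/-- Since `β < 1`, `β z` has imaginary part strictly inside `(-π, π)`, so `e ^ (β z)` is never a
negative real. -/
lemma add_exp_mul_ne_zero (hβ : β ∈ Ioo (0 : ℝ) 1) (hc : 0 < c) {z : ℂ} (hz : |z.im| ≤ Real.pi) :
    (c : ℂ) + Complex.exp (β * z) ≠ 0 := by
  intro h
  have him : Real.sin (β * z.im) = 0 := by
    have := congrArg Complex.im h
    simpa [Complex.exp_im, (Real.exp_pos _).ne'] using this
  have hlt : |β * z.im| < Real.pi := by
    rw [abs_mul, abs_of_pos hβ.1]
    nlinarith [hβ.2, Real.pi_pos, abs_nonneg z.im, hβ.1]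
  have h0 : β * z.im = 0 := (Real.sin_eq_zero_iff_of_lt_of_lt (abs_lt.1 hlt).1 (abs_lt.1 hlt).2).1 him
  have hre := congrArg Complex.re h
  simp [Complex.exp_re, h0] at hre
  linarith [Real.exp_pos (β * z.re)]

/-- The period `2πi` cannot fit between the real axis and a point of the closed strip. Thus `v` is
the only zero of `e ^ z - e ^ v` there, and removing that singularity suffices. -/
lemma eq_ofReal_of_exp_eq {z : ℂ} (hz : |z.im| ≤ Real.pi) {v : ℝ}
    (h : Complex.exp z = Complex.exp v) : z = v := by
  obtain ⟨n, hn⟩ := Complex.exp_eq_exp_iff_exists_int.1 h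
  have him : z.im = n * (2 * Real.pi) := by
    have := congrArg Complex.im hn
    simpa using this
  have : n = 0 := by
    by_contra h0
    have h1 : (1 : ℝ) ≤ |(n : ℝ)| := by exact_mod_cast Int.one_le_abs h0
    rw [him, abs_mul, abs_of_pos (by positivity : (0 : ℝ) < 2 * Real.pi)] at hz
    nlinarith [Real.pi_pos]
  simpa [this] using hn

/-- The kernel `(F z - F v) e ^ z / (e ^ z - e ^ v)` with `F z = 1 / (c + e ^ (β z))`, whose
singularity at `v` is removed. -/
noncomputable def stieltjesKernel (β c v : ℝ) (z : ℂ) : ℂ :=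
  Complex.exp z * dslope (fun z : ℂ ↦ ((c : ℂ) + Complex.exp (β * z))⁻¹) v z /
    dslope Complex.exp v z

lemma stieltjesKernel_of_ne (β c : ℝ) {v : ℝ} {z : ℂ} (hz : z ≠ v) :
    stieltjesKernel β c v z = Complex.exp z *
      (((c : ℂ) + Complex.exp (β * z))⁻¹ - ((c : ℂ) + Complex.exp (β * v))⁻¹) /
        (Complex.exp z - Complex.exp v) := by
  rw [stieltjesKernel, dslope_of_ne _ hz, dslope_of_ne _ hz, slope_def_field, slope_def_field]
  rw [mul_div_assoc, div_div_div_cancel_right₀ (sub_ne_zero.2 hz), mul_div_assoc]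

lemma dslope_exp_ne_zero {v : ℝ} {z : ℂ} (hz : |z.im| ≤ Real.pi) :
    dslope Complex.exp v z ≠ 0 := by
  by_cases h : z = v
  · rw [h, dslope_same, Complex.deriv_exp]; exact Complex.exp_ne_zero _
  · rw [dslope_of_ne _ h, slope_def_field]
    exact div_ne_zero (sub_ne_zero.2 fun h' ↦ h (eq_ofReal_of_exp_eq hz h')) (sub_ne_zero.2 h)

lemma differentiableAt_inv_add_exp (hβ : β ∈ Ioo (0 : ℝ) 1) (hc : 0 < c) {z : ℂ}
    (hz : |z.im| ≤ Real.pi) :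
    DifferentiableAt ℂ (fun z : ℂ ↦ ((c : ℂ) + Complex.exp (β * z))⁻¹) z :=
  DifferentiableAt.fun_inv (by fun_prop) (add_exp_mul_ne_zero hβ hc hz)

lemma continuousAt_stieltjesKernel (hβ : β ∈ Ioo (0 : ℝ) 1) (hc : 0 < c) (v : ℝ) {z : ℂ}
    (hz : |z.im| ≤ Real.pi) : ContinuousAt (stieltjesKernel β c v) z := by
  have h {f : ℂ → ℂ} (hf : DifferentiableAt ℂ f z) : ContinuousAt (dslope f v) z := by
    by_cases hzv : z = v
    · subst hzv; exact continuousAt_dslope_same.2 hf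
    · exact (continuousAt_dslope_of_ne hzv).2 hf.continuousAt
  exact (Complex.continuous_exp.continuousAt.mul (h (differentiableAt_inv_add_exp hβ hc hz))).div
    (h Complex.differentiableAt_exp) (dslope_exp_ne_zero hz)

lemma differentiableAt_stieltjesKernel (hβ : β ∈ Ioo (0 : ℝ) 1) (hc : 0 < c) {v : ℝ} {z : ℂ}
    (hz : |z.im| ≤ Real.pi) (hzv : z ≠ v) : DifferentiableAt ℂ (stieltjesKernel β c v) z :=
  (Complex.differentiableAt_exp.mul ((differentiableAt_dslope_of_ne hzv).2
    (differentiableAt_inv_add_exp hβ hc hz))).div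
    ((differentiableAt_dslope_of_ne hzv).2 Complex.differentiableAt_exp) (dslope_exp_ne_zero hz)

/-- The density of the Stieltjes measure of `l ↦ 1 / (c + l ^ β)` in the logarithmic variable. -/
noncomputable def stieltjesDensity (β c x : ℝ) : ℝ :=
  Real.exp (β * x) * Real.sin (β * Real.pi) /
    ((c + Real.exp (β * x) * Real.cos (β * Real.pi)) ^ 2 +
      (Real.exp (β * x) * Real.sin (β * Real.pi)) ^ 2)

lemma sin_mul_pi_pos (hβ : β ∈ Ioo (0 : ℝ) 1) : 0 < Real.sin (β * Real.pi) :=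
  Real.sin_pos_of_pos_of_lt_pi (by have := hβ.1; positivity)
    (by nlinarith [hβ.2, Real.pi_pos])

lemma stieltjesDensity_pos (hβ : β ∈ Ioo (0 : ℝ) 1) (c x : ℝ) : 0 < stieltjesDensity β c x := by
  have := sin_mul_pi_pos hβ
  unfold stieltjesDensity
  positivity

lemma continuous_stieltjesDensity (hβ : β ∈ Ioo (0 : ℝ) 1) (c : ℝ) :
    Continuous (stieltjesDensity β c) := by
  have := sin_mul_pi_pos hβ
  unfold stieltjesDensity
  refine Continuous.div (by fun_prop) (by fun_prop) fun x ↦ ?_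
  positivity

/-- On both lines `e ^ z = -e ^ x`, so the denominators coincide and the constant `F v` cancels.
What remains is the jump of `F z = 1 / (c + e ^ (β z))`, namely `2i` times the density. -/
lemma stieltjesKernel_sub (hβ : β ∈ Ioo (0 : ℝ) 1) (c v x : ℝ) :
    stieltjesKernel β c v (x + (-Real.pi : ℝ) * Complex.I) -
      stieltjesKernel β c v (x + Real.pi * Complex.I) = 2 * Complex.I *
        ((stieltjesDensity β c x * (Real.exp x / (Real.exp x + Real.exp v)) : ℝ) : ℂ) := by
  have hπ := Real.pi_pos
  have hS := sin_mul_pi_pos hβ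
  have n1 : (x + (-Real.pi : ℝ) * Complex.I : ℂ) ≠ v := fun h ↦ by
    have := congrArg Complex.im h; simp at this
  have n2 : (x + Real.pi * Complex.I : ℂ) ≠ v := fun h ↦ by
    have := congrArg Complex.im h; simp at this
  rw [stieltjesKernel_of_ne β c n1, stieltjesKernel_of_ne β c n2]
  have e1 : Complex.exp (x + (-Real.pi : ℝ) * Complex.I) = -(Real.exp x : ℂ) := by
    rw [Complex.exp_add]; push_cast; rw [neg_mul, Complex.exp_neg, Complex.exp_pi_mul_I]; simp
  have e2 : Complex.exp (x + Real.pi * Complex.I) = -(Real.exp x : ℂ) := by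
    rw [Complex.exp_add, Complex.exp_pi_mul_I]; simp
  have e3 : Complex.exp (β * (x + (-Real.pi : ℝ) * Complex.I)) =
      Real.exp (β * x) * (Real.cos (β * Real.pi) - Real.sin (β * Real.pi) * Complex.I) := by
    rw [mul_add, Complex.exp_add, ← mul_assoc, Complex.exp_mul_I]
    push_cast
    rw [mul_neg, Complex.cos_neg, Complex.sin_neg, neg_mul, sub_eq_add_neg]
  have e4 : Complex.exp (β * (x + Real.pi * Complex.I)) =
      Real.exp (β * x) * (Real.cos (β * Real.pi) + Real.sin (β * Real.pi) * Complex.I) := by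
    rw [mul_add, Complex.exp_add, ← mul_assoc, Complex.exp_mul_I]
    push_cast
    rfl
  rw [e1, e2, e3, e4, ← Complex.ofReal_exp v, stieltjesDensity]
  set E := Real.exp (β * x)
  set C := Real.cos (β * Real.pi)
  set S := Real.sin (β * Real.pi)
  set A := Real.exp x
  set B := Real.exp v
  have hE : 0 < E := Real.exp_pos _
  have hAB : (A + B : ℂ) ≠ 0 := by
    have : 0 < A + B := add_pos (Real.exp_pos _) (Real.exp_pos _)
    exact_mod_cast this.ne'
  have d1 : (c + E * (C - S * Complex.I) : ℂ) ≠ 0 := fun h ↦ by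
    have := congrArg Complex.im h
    simp at this
    exact this.elim hE.ne' hS.ne'
  have d2 : (c + E * (C + S * Complex.I) : ℂ) ≠ 0 := fun h ↦ by
    have := congrArg Complex.im h
    simp at this
    exact this.elim hE.ne' hS.ne'
  have d3 : (((c + E * C) ^ 2 + (E * S) ^ 2 : ℝ) : ℂ) =
      (c + E * (C - S * Complex.I)) * (c + E * (C + S * Complex.I)) := by
    push_cast
    linear_combination (E * S : ℂ) ^ 2 * Complex.I_sq
  have hd : (c + E * (C - S * Complex.I) : ℂ)⁻¹ - (c + E * (C + S * Complex.I) : ℂ)⁻¹ =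
      2 * Complex.I * ((E * S / ((c + E * C) ^ 2 + (E * S) ^ 2) : ℝ) : ℂ) := by
    rw [Complex.ofReal_div, d3, inv_sub_inv d1 d2]
    push_cast
    ring
  rw [Complex.ofReal_mul, ← mul_assoc, ← hd, ← sub_div, ← mul_sub, sub_sub_sub_cancel_right]
  push_cast
  rw [show (-(A : ℂ) - B) = -(A + B) by ring, neg_mul, neg_div_neg_eq]
  ring

/-- As the real part tends to `+∞`, `F z → 0` and `e ^ z / (e ^ z - e ^ v) = 1 + e ^ v / (e ^ z - e
^ v) → 1`, so the kernel tends to `-F v`, uniformly in `y`. -/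
lemma norm_stieltjesKernel_add_le (hc : 0 < c) {v R : ℝ} (y : ℝ)
    (hR : Real.exp v < Real.exp R) (hR' : c < Real.exp (β * R)) :
    ‖stieltjesKernel β c v (R + y * Complex.I) + (c + Real.exp (β * v) : ℝ)⁻¹‖ ≤
      (Real.exp (β * R) - c)⁻¹ * (1 + Real.exp v * (Real.exp R - Real.exp v)⁻¹) +
        (c + Real.exp (β * v))⁻¹ * (Real.exp v * (Real.exp R - Real.exp v)⁻¹) := by
  set z : ℂ := R + y * Complex.I with hz
  have hne : z ≠ v := fun h ↦ by
    have := congrArg Complex.re h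
    simp [hz] at this
    rw [this] at hR
    exact lt_irrefl _ hR
  have hn1 : ‖Complex.exp z‖ = Real.exp R := by rw [Complex.norm_exp]; simp [hz]
  have hn2 : ‖Complex.exp (β * z)‖ = Real.exp (β * R) := by rw [Complex.norm_exp]; simp [hz]
  have hn3 : ‖Complex.exp (v : ℂ)‖ = Real.exp v := by rw [Complex.norm_exp]; simp
  have hd1 : Real.exp R - Real.exp v ≤ ‖Complex.exp z - Complex.exp v‖ := by
    have := norm_sub_norm_le (Complex.exp z) (Complex.exp v)
    rwa [hn1, hn3] at this
  have hd2 : Real.exp (β * R) - c ≤ ‖(c : ℂ) + Complex.exp (β * z)‖ := by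
    have := norm_sub_norm_le (Complex.exp (β * z)) (-(c : ℂ))
    rwa [hn2, norm_neg, Complex.norm_real, Real.norm_of_nonneg hc.le, sub_neg_eq_add,
      add_comm (Complex.exp _)] at this
  have hp1 : 0 < Real.exp R - Real.exp v := sub_pos.2 hR
  have hp2 : 0 < Real.exp (β * R) - c := sub_pos.2 hR'
  have hne2 : Complex.exp z - Complex.exp v ≠ 0 := norm_pos_iff.1 (hp1.trans_le hd1)
  have hF : ((c : ℂ) + Complex.exp (β * v))⁻¹ = ((c + Real.exp (β * v) : ℝ)⁻¹ : ℂ) := by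
    push_cast; rfl
  have key : stieltjesKernel β c v z + ((c + Real.exp (β * v) : ℝ)⁻¹ : ℂ) =
      ((c : ℂ) + Complex.exp (β * z))⁻¹ *
        (1 + Complex.exp v * (Complex.exp z - Complex.exp v)⁻¹) -
      ((c + Real.exp (β * v) : ℝ)⁻¹ : ℂ) *
        (Complex.exp v * (Complex.exp z - Complex.exp v)⁻¹) := by
    rw [stieltjesKernel_of_ne β c hne, hF]
    field_simp
    ring
  have hi : ‖Complex.exp (v : ℂ) * (Complex.exp z - Complex.exp v)⁻¹‖ ≤
      Real.exp v * (Real.exp R - Real.exp v)⁻¹ := by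
    rw [norm_mul, norm_inv, hn3]; gcongr
  have hj : ‖((c + Real.exp (β * v) : ℝ)⁻¹ : ℂ)‖ = (c + Real.exp (β * v))⁻¹ := by
    rw [norm_inv, Complex.norm_real, Real.norm_of_nonneg (by positivity)]
  push_cast at key hj ⊢
  rw [key]
  refine (norm_sub_le _ _).trans ?_
  rw [norm_mul, norm_mul _ (Complex.exp (v : ℂ) * (Complex.exp z - Complex.exp v)⁻¹), hj, norm_inv]
  gcongr
  exact (norm_add_le _ _).trans (by rw [norm_one]; gcongr)

/-- At the left end the factor `e ^ z` makes the kernel vanish, uniformly in `y`. -/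
lemma norm_stieltjesKernel_le (hc : 0 < c) {v R : ℝ} (y : ℝ)
    (hR : Real.exp R < Real.exp v) (hR' : Real.exp (β * R) < c) :
    ‖stieltjesKernel β c v (R + y * Complex.I)‖ ≤
      Real.exp R * ((c - Real.exp (β * R))⁻¹ + (c + Real.exp (β * v))⁻¹) /
        (Real.exp v - Real.exp R) := by
  set z : ℂ := R + y * Complex.I with hz
  have hne : z ≠ v := fun h ↦ by
    have := congrArg Complex.re h
    simp [hz] at this
    rw [this] at hR
    exact lt_irrefl _ hR
  have hn1 : ‖Complex.exp z‖ = Real.exp R := by rw [Complex.norm_exp]; simp [hz]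
  have hn2 : ‖Complex.exp (β * z)‖ = Real.exp (β * R) := by rw [Complex.norm_exp]; simp [hz]
  have hn3 : ‖Complex.exp (v : ℂ)‖ = Real.exp v := by rw [Complex.norm_exp]; simp
  have hd1 : Real.exp v - Real.exp R ≤ ‖Complex.exp z - Complex.exp v‖ := by
    have := norm_sub_norm_le (Complex.exp (v : ℂ)) (Complex.exp z)
    rwa [hn1, hn3, norm_sub_rev] at this
  have hd2 : c - Real.exp (β * R) ≤ ‖(c : ℂ) + Complex.exp (β * z)‖ := by
    have := norm_sub_norm_le (c : ℂ) (-Complex.exp (β * z))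
    rwa [norm_neg, hn2, Complex.norm_real, Real.norm_of_nonneg hc.le, sub_neg_eq_add] at this
  have hp1 : 0 < Real.exp v - Real.exp R := sub_pos.2 hR
  have hp2 : 0 < c - Real.exp (β * R) := sub_pos.2 hR'
  have hF : ‖((c : ℂ) + Complex.exp (β * v))⁻¹‖ = (c + Real.exp (β * v))⁻¹ := by
    rw [show ((c : ℂ) + Complex.exp (β * v)) = ((c + Real.exp (β * v) : ℝ) : ℂ) by push_cast; rfl,
      norm_inv, Complex.norm_real, Real.norm_of_nonneg (by positivity)]
  rw [stieltjesKernel_of_ne β c hne, norm_div, norm_mul, hn1]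
  gcongr
  refine (norm_sub_le _ _).trans ?_
  rw [hF, norm_inv]
  gcongr

/-- Cauchy's theorem on `[-R, R] × [-π, π]`: the horizontal sides give twice the integral (up to
`i`), the left side tends to `0` and the right side to `-2π F v`. -/
lemma tendsto_integral_stieltjesDensity (hβ : β ∈ Ioo (0 : ℝ) 1) (hc : 0 < c) (v : ℝ) :
    Tendsto (fun R : ℝ ↦ ∫ x in (-R)..R,
      stieltjesDensity β c x * (Real.exp x / (Real.exp x + Real.exp v))) atTop
      (𝓝 (Real.pi * (c + Real.exp (β * v))⁻¹)) := by
  have hπ := Real.pi_pos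
  set H := stieltjesKernel β c v with hH
  set k : ℝ := (c + Real.exp (β * v))⁻¹ with hk
  have hcont {z : ℂ} (hz : |z.im| ≤ Real.pi) : ContinuousAt H z :=
    continuousAt_stieltjesKernel hβ hc v hz
  have hrect (R : ℝ) : (2 * ∫ x in (-R)..R,
      stieltjesDensity β c x * (Real.exp x / (Real.exp x + Real.exp v)) : ℝ) =
      (∫ y in (-Real.pi)..Real.pi, H ((-R : ℝ) + y * Complex.I)) -
        ∫ y in (-Real.pi)..Real.pi, H (R + y * Complex.I) := by
    -- At the removed singularity `v` continuity is enough, as a countable exceptional set is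
    -- allowed.
    have h := Complex.integral_boundary_rect_eq_zero_of_differentiable_on_off_countable H
      ⟨-R, -Real.pi⟩ ⟨R, Real.pi⟩ {(v : ℂ)} (countable_singleton _) (fun z hz ↦ by
        refine (hcont ?_).continuousWithinAt
        have := hz.2
        rw [mem_preimage, uIcc_of_le (by linarith)] at this
        exact abs_le.2 this) (fun z hz ↦ by
        refine differentiableAt_stieltjesKernel hβ hc ?_ hz.2
        have := hz.1.2
        rw [mem_preimage, min_eq_left (by simp; linarith), max_eq_right (by simp; linarith)] at this
        exact abs_le.2 ⟨this.1.le, this.2.le⟩)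
    dsimp only at h
    have hc1 : Continuous fun x : ℝ ↦ H (x + (-Real.pi : ℝ) * Complex.I) :=
      continuous_iff_continuousAt.2 fun x ↦ ContinuousAt.comp (f := fun x : ℝ ↦
        (x + (-Real.pi : ℝ) * Complex.I : ℂ)) (hcont (by simp [abs_of_pos hπ])) (by fun_prop)
    have hc2 : Continuous fun x : ℝ ↦ H (x + Real.pi * Complex.I) :=
      continuous_iff_continuousAt.2 fun x ↦ ContinuousAt.comp (f := fun x : ℝ ↦
        (x + Real.pi * Complex.I : ℂ)) (hcont (by simp [abs_of_pos hπ])) (by fun_prop)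
    rw [← intervalIntegral.integral_sub (hc1.intervalIntegrable _ _) (hc2.intervalIntegrable _ _)]
      at h
    simp_rw [hH, stieltjesKernel_sub hβ] at h
    rw [intervalIntegral.integral_const_mul, intervalIntegral.integral_ofReal, smul_eq_mul,
      smul_eq_mul] at h
    rw [hH]
    push_cast
    push_cast at h
    refine mul_left_cancel₀ Complex.I_ne_zero ?_
    linear_combination h
  have hexp : Tendsto (fun R : ℝ ↦ (Real.exp R - Real.exp v)⁻¹) atTop (𝓝 0) :=
    tendsto_inv_atTop_zero.comp (tendsto_atTop_add_const_right _ _ Real.tendsto_exp_atTop)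
  have hbR : Tendsto (fun R : ℝ ↦ Real.exp (β * R)) atTop atTop :=
    Real.tendsto_exp_atTop.comp (tendsto_id.const_mul_atTop hβ.1)
  have hexpβ : Tendsto (fun R : ℝ ↦ (Real.exp (β * R) - c)⁻¹) atTop (𝓝 0) :=
    tendsto_inv_atTop_zero.comp (tendsto_atTop_add_const_right _ _ hbR)
  have hneg : Tendsto (fun R : ℝ ↦ Real.exp (-R)) atTop (𝓝 0) :=
    Real.tendsto_exp_atBot.comp tendsto_neg_atTop_atBot
  have hnegβ : Tendsto (fun R : ℝ ↦ Real.exp (β * -R)) atTop (𝓝 0) :=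
    Real.tendsto_exp_atBot.comp (tendsto_neg_atTop_atBot.const_mul_atBot hβ.1)
  have hright : Tendsto (fun R : ℝ ↦ ∫ y in (-Real.pi)..Real.pi, H (R + y * Complex.I)) atTop
      (𝓝 (-(2 * Real.pi * k : ℝ))) := by
    rw [tendsto_iff_norm_sub_tendsto_zero]
    have hlim : Tendsto (fun R : ℝ ↦ ((Real.exp (β * R) - c)⁻¹ *
        (1 + Real.exp v * (Real.exp R - Real.exp v)⁻¹) +
        k * (Real.exp v * (Real.exp R - Real.exp v)⁻¹)) * |Real.pi - -Real.pi|) atTop (𝓝 0) := by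
      simpa using ((hexpβ.mul ((hexp.const_mul (Real.exp v)).const_add 1)).add
        ((hexp.const_mul (Real.exp v)).const_mul k)).mul_const |Real.pi - -Real.pi|
    refine squeeze_zero' (Eventually.of_forall fun R ↦ norm_nonneg _) ?_ hlim
    filter_upwards [Real.tendsto_exp_atTop.eventually_gt_atTop (Real.exp v),
      hbR.eventually_gt_atTop c] with R h1 h2
    have hcR : IntervalIntegrable (fun y : ℝ ↦ H (R + y * Complex.I)) volume (-Real.pi) Real.pi := by
      refine ContinuousOn.intervalIntegrable fun y hy ↦ ContinuousAt.continuousWithinAt ?_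
      rw [uIcc_of_le (by linarith)] at hy
      exact ContinuousAt.comp (f := fun y : ℝ ↦ (R + y * Complex.I : ℂ))
        (hcont (by simpa using abs_le.2 hy)) (by fun_prop)
    have e : (∫ y in (-Real.pi)..Real.pi, H (R + y * Complex.I)) - (-((2 * Real.pi * k : ℝ) : ℂ)) =
        ∫ y in (-Real.pi)..Real.pi, (H (R + y * Complex.I) + k) := by
      rw [intervalIntegral.integral_add hcR intervalIntegrable_const,
        intervalIntegral.integral_const, Complex.real_smul]
      push_cast
      ring
    rw [e]
    refine intervalIntegral.norm_integral_le_of_norm_le_const fun y _ ↦ ?_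
    have := norm_stieltjesKernel_add_le hc y h1 h2
    simpa [hk] using this
  have hleft : Tendsto (fun R : ℝ ↦ ∫ y in (-Real.pi)..Real.pi, H ((-R : ℝ) + y * Complex.I)) atTop
      (𝓝 0) := by
    have hlim : Tendsto (fun R : ℝ ↦ (Real.exp (-R) * ((c - Real.exp (β * -R))⁻¹ + k) /
        (Real.exp v - Real.exp (-R))) * |Real.pi - -Real.pi|) atTop (𝓝 0) := by
      have := ((hneg.mul (((hnegβ.const_sub c).inv₀ (by simpa using hc.ne')).add_const k)).div
        (hneg.const_sub (Real.exp v)) (by simp)).mul_const |Real.pi - -Real.pi|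
      simpa using this
    refine squeeze_zero_norm' ?_ hlim
    filter_upwards [hneg.eventually_lt_const (Real.exp_pos v), hnegβ.eventually_lt_const hc]
      with R h1 h2
    exact intervalIntegral.norm_integral_le_of_norm_le_const fun y _ ↦
      norm_stieltjesKernel_le hc y h1 h2
  have hfin := (Complex.continuous_re.tendsto _).comp (hleft.sub hright)
  have := hfin.const_mul (1 / 2)
  convert! this using 1
  · ext R
    rw [Function.comp, ← hrect R, Complex.ofReal_re]
    ring
  · congr 1
    simp
    ring

lemma integral_stieltjesDensity (hβ : β ∈ Ioo (0 : ℝ) 1) (hc : 0 < c) (v : ℝ) :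
    Integrable (fun x ↦ stieltjesDensity β c x * (Real.exp x / (Real.exp x + Real.exp v))) ∧
      ∫ x, stieltjesDensity β c x * (Real.exp x / (Real.exp x + Real.exp v)) =
        Real.pi * (c + Real.exp (β * v))⁻¹ := by
  have hlim := tendsto_integral_stieltjesDensity hβ hc v
  have hcont : Continuous fun x ↦ stieltjesDensity β c x *
      (Real.exp x / (Real.exp x + Real.exp v)) :=
    (continuous_stieltjesDensity hβ c).mul
      (Real.continuous_exp.div (by fun_prop) fun x ↦ by positivity)
  have hint : Integrable fun x ↦ stieltjesDensity β c x *
      (Real.exp x / (Real.exp x + Real.exp v)) := by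
    -- The integrand is positive, so convergence over `[-R, R]` already gives integrability.
    refine integrable_of_intervalIntegral_norm_tendsto _ (fun R ↦
      (hcont.integrableOn_Icc (a := -R) (b := R)).mono_set Ioc_subset_Icc_self)
      tendsto_neg_atTop_atBot tendsto_id (hlim.congr fun R ↦ ?_)
    refine intervalIntegral.integral_congr fun x _ ↦ ?_
    have := stieltjesDensity_pos hβ c x
    rw [Real.norm_of_nonneg (by positivity)]
  exact ⟨hint, tendsto_nhds_unique
    (intervalIntegral_tendsto_integral hint tendsto_neg_atTop_atBot tendsto_id) hlim⟩

/-- `l ↦ 1 / (c + l ^ β)` is a Stieltjes function for `0 < β ≤ 1`. -/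
theorem exists_stieltjes_measure (hβ : β ∈ Ioc (0 : ℝ) 1) (hc : 0 < c) :
    ∃ ν : Measure ℝ, SFinite ν ∧ ∀ l : ℝ, 0 ≤ l →
      ∫⁻ y, ENNReal.ofReal (Real.exp y + l)⁻¹ ∂ν = ENNReal.ofReal (c + l ^ β)⁻¹ := by
  -- For `β = 1` the density degenerates (`sin π = 0`) and the measure is a point mass at `log c`.
  rcases hβ.2.eq_or_lt with rfl | hβ1
  · refine ⟨Measure.dirac (Real.log c), inferInstance, fun l _ ↦ ?_⟩
    rw [lintegral_dirac, Real.exp_log hc, Real.rpow_one]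
  have hβ' : β ∈ Ioo (0 : ℝ) 1 := ⟨hβ.1, hβ1⟩
  set g : ℝ → ℝ := fun y ↦ stieltjesDensity β c y * Real.exp y / Real.pi with hg
  have hgc : Continuous g :=
    ((continuous_stieltjesDensity hβ' c).mul Real.continuous_exp).div_const _
  have hg0 (y : ℝ) : 0 < g y := by
    have := stieltjesDensity_pos hβ' c y
    have := Real.pi_pos
    positivity
  set ν : Measure ℝ := volume.withDensity fun y ↦ ENNReal.ofReal (g y) with hν
  have hmeas (l : ℝ) : Measurable fun y ↦ ENNReal.ofReal (Real.exp y + l)⁻¹ := by fun_prop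
  have hpos (l : ℝ) (hl : 0 < l) :
      ∫⁻ y, ENNReal.ofReal (Real.exp y + l)⁻¹ ∂ν = ENNReal.ofReal (c + l ^ β)⁻¹ := by
    obtain ⟨hint, hval⟩ := integral_stieltjesDensity hβ' hc (Real.log l)
    have heq (y : ℝ) : g y * (Real.exp y + l)⁻¹ = stieltjesDensity β c y *
        (Real.exp y / (Real.exp y + Real.exp (Real.log l))) * Real.pi⁻¹ := by
      rw [Real.exp_log hl, hg]; ring
    rw [hν, lintegral_withDensity_eq_lintegral_mul _ hgc.measurable.ennreal_ofReal (hmeas l)]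
    simp only [Pi.mul_apply]
    simp_rw [← ENNReal.ofReal_mul (hg0 _).le, heq]
    rw [← ofReal_integral_eq_lintegral_ofReal (hint.mul_const _), integral_mul_const, hval,
      mul_comm β, ← Real.rpow_def_of_pos hl]
    · congr 1
      field_simp
    · refine Eventually.of_forall fun y ↦ ?_
      have := (hg0 y).le
      dsimp only [Pi.zero_apply]
      rw [← heq]
      positivity
  refine ⟨ν, inferInstance, fun l hl ↦ ?_⟩
  -- The contour argument needs `l = e ^ v > 0`; `l = 0` follows by monotone convergence along `1 /
  -- (n + 1)`.
  rcases hl.eq_or_lt with rfl | hl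
  · have hu (n : ℕ) : 0 < 1 / ((n : ℝ) + 1) := by positivity
    have hu0 := tendsto_one_div_add_atTop_nhds_zero_nat (𝕜 := ℝ)
    have h1 : Tendsto (fun n : ℕ ↦ ∫⁻ y, ENNReal.ofReal (Real.exp y + 1 / ((n : ℝ) + 1))⁻¹ ∂ν) atTop
        (𝓝 (∫⁻ y, ENNReal.ofReal (Real.exp y + 0)⁻¹ ∂ν)) := by
      refine lintegral_tendsto_of_tendsto_of_monotone (fun n ↦ (hmeas _).aemeasurable)
        (Eventually.of_forall fun y m n hmn ↦ ?_) (Eventually.of_forall fun y ↦ ?_)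
      · dsimp only; gcongr
      · exact ENNReal.tendsto_ofReal ((hu0.const_add _).inv₀ (by positivity))
    refine tendsto_nhds_unique h1 ?_
    simp_rw [hpos _ (hu _)]
    refine ENNReal.tendsto_ofReal (((hu0.rpow_const (Or.inr hβ.1.le)).const_add c).inv₀ ?_)
    rw [Real.zero_rpow hβ.1.ne']; positivity
  · exact hpos l hl

/-- For `0 < β ≤ 1`, `l ↦ 1 / (c + l ^ β)` is the Laplace transform of a positive random variable
under a finite measure. -/
theorem exists_measure_laplace (hβ : β ∈ Ioc (0 : ℝ) 1) (hc : 0 < c) :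
    ∃ μ : Measure (ℝ × ℝ), IsFiniteMeasure μ ∧ (∀ᵐ p ∂μ, 0 < p.2) ∧ ∀ l : ℝ, 0 ≤ l →
      ∫ p, Real.exp (-(l * p.2)) ∂μ = (c + l ^ β)⁻¹ := by
  obtain ⟨ν, _, hν⟩ := exists_stieltjes_measure hβ hc
  -- Since `1 / (e ^ y + l) = ∫_0^∞ e^{-r e ^ y} e^{-l r} dr`, the measure `e^{-r e ^ y} ν(dy) dr`
  -- works, with `r` as the random variable; `l = 0` gives its total mass `1 / c`.
  set ρ : Measure ℝ := volume.restrict (Ioi 0) with hρ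
  set f : ℝ × ℝ → ENNReal := fun p ↦ ENNReal.ofReal (Real.exp (-(Real.exp p.1 * p.2))) with hf
  have hfm : Measurable f := by fun_prop
  set μ : Measure (ℝ × ℝ) := (ν.prod ρ).withDensity f with hμ
  have hinner (s : ℝ) (hs : 0 < s) :
      ∫⁻ r, ENNReal.ofReal (Real.exp (-s * r)) ∂ρ = ENNReal.ofReal s⁻¹ := by
    rw [← ofReal_integral_eq_lintegral_ofReal (exp_neg_integrableOn_Ioi 0 hs)
      (Eventually.of_forall fun r ↦ (Real.exp_pos _).le), integral_exp_mul_Ioi (neg_lt_zero.2 hs)]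
    congr 1
    simp [neg_div_neg_eq]
  have hlap (l : ℝ) (hl : 0 ≤ l) :
      ∫⁻ p, ENNReal.ofReal (Real.exp (-(l * p.2))) ∂μ = ENNReal.ofReal (c + l ^ β)⁻¹ := by
    rw [hμ, lintegral_withDensity_eq_lintegral_mul _ hfm (by fun_prop),
      lintegral_prod _ (by fun_prop), ← hν l hl]
    refine lintegral_congr fun y ↦ ?_
    rw [← hinner _ (by positivity)]
    refine lintegral_congr fun r ↦ ?_
    rw [Pi.mul_apply, hf, ← ENNReal.ofReal_mul (Real.exp_pos _).le, ← Real.exp_add]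
    congr 2; ring
  refine ⟨μ, ⟨?_⟩, ?_, fun l hl ↦ ?_⟩
  · have := hlap 0 le_rfl
    simp only [zero_mul, neg_zero, Real.exp_zero, ENNReal.ofReal_one, lintegral_one] at this
    rw [this]
    exact ENNReal.ofReal_lt_top
  · refine (withDensity_absolutelyContinuous _ _).ae_le ?_
    have : ∀ᵐ r ∂ρ, 0 < r := ae_restrict_mem measurableSet_Ioi
    exact Measure.quasiMeasurePreserving_snd.ae this
  · rw [integral_eq_lintegral_of_nonneg_ae (Eventually.of_forall fun p ↦ (Real.exp_pos _).le)
      (by fun_prop), hlap l hl, ENNReal.toReal_ofReal (by positivity)]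

end Stieltjes

/-! ### The subordinator at an independent exponential time -/

lemma integral_exp_neg_mul_expMeasure {c s : ℝ} (hc : 0 < c) (hs : 0 ≤ s) :
    ∫ u, Real.exp (-(u * s)) ∂(expMeasure c) = c / (c + s) := by
  have h1 : expMeasure c = volume.withDensity (exponentialPDF c) := rfl
  rw [integral_eq_lintegral_of_nonneg_ae (Eventually.of_forall fun u ↦ (Real.exp_pos _).le)
    (by fun_prop), h1, lintegral_withDensity_eq_lintegral_mul _
      (f := exponentialPDF c) (measurable_exponentialPDFReal c).ennreal_ofReal (by fun_prop)]
  have h2 : ∀ u, (exponentialPDF c * fun u ↦ ENNReal.ofReal (Real.exp (-(u * s)))) u =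
      (Ici 0).indicator (fun u ↦ ENNReal.ofReal (c * Real.exp (-(c + s) * u))) u := fun u ↦ by
    rw [Pi.mul_apply, exponentialPDF_eq]
    by_cases hu : 0 ≤ u
    · rw [if_pos hu, indicator_of_mem (mem_Ici.2 hu), ← ENNReal.ofReal_mul (by positivity),
        mul_assoc, ← Real.exp_add]
      congr 3; ring
    · simp [hu]
  have hcs : 0 < c + s := by positivity
  rw [lintegral_congr h2, lintegral_indicator measurableSet_Ici,
    setLIntegral_congr Ioi_ae_eq_Ici.symm, ← ofReal_integral_eq_lintegral_ofReal
      ((exp_neg_integrableOn_Ioi 0 hcs).const_mul c) (Eventually.of_forall fun u ↦ by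
        dsimp only [Pi.zero_apply]; positivity), integral_const_mul,
      integral_exp_mul_Ioi (neg_lt_zero.2 hcs), mul_zero, Real.exp_zero,
      neg_div_neg_eq, ENNReal.toReal_ofReal (by positivity), mul_one_div]

/-- A grid approximation of `t` from above with mesh `1 / (k + 1)`. -/
noncomputable def gridAbove (k : ℕ) (t : ℝ≥0) : ℝ≥0 := (⌊((k : ℝ≥0) + 1) * t⌋₊ + 1) / (k + 1)

lemma le_gridAbove (k : ℕ) (t : ℝ≥0) : t ≤ gridAbove k t := by
  rw [gridAbove, le_div_iff₀ (by positivity), mul_comm]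
  exact (Nat.lt_floor_add_one _).le

lemma gridAbove_le (k : ℕ) (t : ℝ≥0) : gridAbove k t ≤ t + 1 / (k + 1) := by
  rw [gridAbove, div_le_iff₀ (by positivity), add_mul t, one_div,
    inv_mul_cancel₀ (by positivity), mul_comm t]
  gcongr
  exact Nat.floor_le zero_le

/-- The approximation is from above because the paths are only right-continuous. -/
lemma tendsto_gridAbove (t : ℝ≥0) : Tendsto (fun k ↦ gridAbove k t) atTop (𝓝[≥] t) := by
  refine tendsto_nhdsWithin_iff.2 ⟨?_, Eventually.of_forall fun k ↦ le_gridAbove k t⟩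
  have h : Tendsto (fun k : ℕ ↦ t + 1 / ((k : ℝ≥0) + 1)) atTop (𝓝 t) := by
    simpa using (tendsto_one_div_add_atTop_nhds_zero_nat (𝕜 := ℝ≥0)).const_add t
  exact tendsto_of_tendsto_of_tendsto_of_le_of_le tendsto_const_nhds h
    (fun k ↦ le_gridAbove k t) (fun k ↦ gridAbove_le k t)

lemma measurable_gridAbove (k : ℕ) : Measurable (gridAbove k) := by
  have h : Measurable fun j : ℕ ↦ ((j : ℝ≥0) + 1) / (k + 1) := measurable_from_nat
  exact h.comp (Nat.measurable_floor.comp (measurable_const.mul measurable_id))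

/-- Evaluation `(t, f) ↦ f t` is not jointly measurable on the space of all paths; it becomes so
once the time is rounded to a countable grid. -/
lemma measurable_eval_gridAbove (k : ℕ) :
    Measurable fun p : ℝ≥0 × (ℝ≥0 → ℝ) ↦ p.2 (gridAbove k p.1) := by
  have h : Measurable fun p : ℕ × (ℝ≥0 → ℝ) ↦ p.2 (((p.1 : ℝ≥0) + 1) / (k + 1)) :=
    measurable_from_prod_countable_right fun j ↦ measurable_pi_apply (((j : ℝ≥0) + 1) / (k + 1))
  have h2 : Measurable fun p : ℝ≥0 × (ℝ≥0 → ℝ) ↦ (⌊((k : ℝ≥0) + 1) * p.1⌋₊, p.2) :=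
    (Nat.measurable_floor.comp (measurable_const.mul measurable_fst)).prodMk measurable_snd
  exact h.comp h2

section Subordinator

variable {Ω : Type*} [MeasurableSpace Ω] {P : Measure Ω} {β : ℝ} {σ : ℝ≥0 → Ω → ℝ} {τ : Ω → ℝ≥0}

lemma IsStableSubordinator.ae_nonneg (hσ : IsStableSubordinator β σ P) :
    ∀ᵐ ω ∂P, ∀ t, 0 ≤ σ t ω := by
  filter_upwards [hσ.zero, hσ.monotone] with ω h0 hm t
  rw [← h0]; exact hm zero_le

lemma IsStableSubordinator.ae_tendsto_gridAbove (hσ : IsStableSubordinator β σ P) :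
    ∀ᵐ ω ∂P, Tendsto (fun k ↦ σ (gridAbove k (τ ω)) ω) atTop (𝓝 (σ (τ ω) ω)) := by
  filter_upwards [hσ.rightContinuous] with ω h
  exact (h (τ ω)).tendsto.comp (tendsto_gridAbove (τ ω))

lemma IsStableSubordinator.measurable_gridAbove (hσ : IsStableSubordinator β σ P)
    (hτ : Measurable τ) (k : ℕ) : Measurable fun ω ↦ σ (gridAbove k (τ ω)) ω :=
  (measurable_eval_gridAbove k).comp (hτ.prodMk (measurable_pi_lambda _ hσ.measurable))

lemma IsStableSubordinator.aemeasurable_comp (hσ : IsStableSubordinator β σ P)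
    (hτ : Measurable τ) : AEMeasurable (fun ω ↦ σ (τ ω) ω) P :=
  aemeasurable_of_tendsto_metrizable_ae atTop
    (fun k ↦ (hσ.measurable_gridAbove hτ k).aemeasurable) hσ.ae_tendsto_gridAbove

variable [IsProbabilityMeasure P]

/-- By independence the joint law of time and path is a product, so Fubini freezes the time and the
fixed-time Laplace transform applies. -/
lemma IsStableSubordinator.integral_exp_gridAbove (hσ : IsStableSubordinator β σ P)
    (hτ : Measurable τ) (hind : IndepFun τ (fun ω t ↦ σ t ω) P) (k : ℕ) {l : ℝ} (hl : 0 ≤ l) :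
    ∫ ω, Real.exp (-(l * σ (gridAbove k (τ ω)) ω)) ∂P =
      ∫ ω, Real.exp (-((gridAbove k (τ ω) : ℝ) * l ^ β)) ∂P := by
  have hpath : Measurable fun ω t ↦ σ t ω := measurable_pi_lambda _ hσ.measurable
  set g : ℝ≥0 × (ℝ≥0 → ℝ) → ℝ := fun p ↦ Real.exp (-(l * p.2 (gridAbove k p.1))) with hg
  have hgm : Measurable g :=
    Real.measurable_exp.comp ((measurable_eval_gridAbove k).const_mul l).neg
  have hpair : Measurable fun ω ↦ (τ ω, fun t ↦ σ t ω) := hτ.prodMk hpath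
  have hmap := (indepFun_iff_map_prod_eq_prod_map_map hτ.aemeasurable hpath.aemeasurable).1 hind
  have hint : Integrable g (P.map fun ω ↦ (τ ω, fun t ↦ σ t ω)) := by
    rw [integrable_map_measure hgm.aestronglyMeasurable hpair.aemeasurable]
    refine (integrable_const (1 : ℝ)).mono' (hgm.comp hpair).aestronglyMeasurable ?_
    filter_upwards [hσ.ae_nonneg] with ω hω
    rw [Function.comp, Real.norm_of_nonneg (Real.exp_pos _).le, Real.exp_le_one_iff, neg_nonpos]
    exact mul_nonneg hl (hω _)
  have h1 : ∫ ω, Real.exp (-(l * σ (gridAbove k (τ ω)) ω)) ∂P =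
      ∫ p, g p ∂(P.map fun ω ↦ (τ ω, fun t ↦ σ t ω)) :=
    (integral_map hpair.aemeasurable hgm.aestronglyMeasurable).symm
  have h2 (t : ℝ≥0) : ∫ p, g (t, p) ∂(P.map fun ω t ↦ σ t ω) =
      Real.exp (-((gridAbove k t : ℝ) * l ^ β)) := by
    rw [integral_map hpath.aemeasurable (f := fun p ↦ g (t, p))
      (hgm.comp measurable_prodMk_left).aestronglyMeasurable]
    exact hσ.laplace (gridAbove k t) l hl
  rw [hmap] at hint h1
  rw [h1, integral_prod _ hint]
  simp_rw [h2]
  refine integral_map hτ.aemeasurable (Measurable.aestronglyMeasurable ?_)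
  have := _root_.measurable_gridAbove k
  fun_prop

/-- The Laplace transform of a stable subordinator stopped at an independent exponential time. -/
theorem IsStableSubordinator.integral_exp_comp (hσ : IsStableSubordinator β σ P)
    (hτ : Measurable τ) {c : ℝ} (hc : 0 < c) (hexp : P.map (fun ω ↦ (τ ω : ℝ)) = expMeasure c)
    (hind : IndepFun τ (fun ω t ↦ σ t ω) P) {l : ℝ} (hl : 0 ≤ l) :
    ∫ ω, Real.exp (-(l * σ (τ ω) ω)) ∂P = c / (c + l ^ β) := by
  have hlβ : 0 ≤ l ^ β := Real.rpow_nonneg hl β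
  have h1 : Tendsto (fun k ↦ ∫ ω, Real.exp (-(l * σ (gridAbove k (τ ω)) ω)) ∂P) atTop
      (𝓝 (∫ ω, Real.exp (-(l * σ (τ ω) ω)) ∂P)) := by
    refine tendsto_integral_of_dominated_convergence (fun _ ↦ 1) (fun k ↦ ?_)
      (integrable_const _) (fun k ↦ ?_) ?_
    · exact (Real.measurable_exp.comp
        ((hσ.measurable_gridAbove hτ k).const_mul l).neg).aestronglyMeasurable
    · filter_upwards [hσ.ae_nonneg] with ω hω
      rw [Real.norm_of_nonneg (Real.exp_pos _).le, Real.exp_le_one_iff, neg_nonpos]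
      exact mul_nonneg hl (hω _)
    · filter_upwards [hσ.ae_tendsto_gridAbove (τ := τ)] with ω hω
      exact (Real.continuous_exp.tendsto _).comp (hω.const_mul l).neg
  have h2 : Tendsto (fun k ↦ ∫ ω, Real.exp (-((gridAbove k (τ ω) : ℝ) * l ^ β)) ∂P) atTop
      (𝓝 (∫ ω, Real.exp (-((τ ω : ℝ) * l ^ β)) ∂P)) := by
    refine tendsto_integral_of_dominated_convergence (fun _ ↦ 1) (fun k ↦ ?_)
      (integrable_const _) (fun k ↦ Eventually.of_forall fun ω ↦ ?_)
      (Eventually.of_forall fun ω ↦ ?_)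
    · have := (_root_.measurable_gridAbove k).comp hτ
      exact (Real.measurable_exp.comp
        (this.coe_nnreal_real.mul_const _).neg).aestronglyMeasurable
    · rw [Real.norm_of_nonneg (Real.exp_pos _).le, Real.exp_le_one_iff, neg_nonpos]
      positivity
    · have := (NNReal.continuous_coe.tendsto _).comp
        (tendsto_nhds_of_tendsto_nhdsWithin (tendsto_gridAbove (τ ω)))
      exact (Real.continuous_exp.tendsto _).comp (this.mul_const _).neg
  simp_rw [hσ.integral_exp_gridAbove hτ hind _ hl] at h1
  rw [tendsto_nhds_unique h1 h2, ← integral_exp_neg_mul_expMeasure hc hlβ, ← hexp,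
    integral_map hτ.coe_nnreal_real.aemeasurable (by fun_prop)]

/-- As `n → ∞`, `E[e^{-n X}]` tends to `P(X = 0)`, while its value `c / (c + n ^ β)` tends to `0`.
-/
lemma IsStableSubordinator.ae_pos_comp (hσ : IsStableSubordinator β σ P) (hβ : 0 < β)
    (hτ : Measurable τ) {c : ℝ} (hc : 0 < c) (hexp : P.map (fun ω ↦ (τ ω : ℝ)) = expMeasure c)
    (hind : IndepFun τ (fun ω t ↦ σ t ω) P) : ∀ᵐ ω ∂P, 0 < σ (τ ω) ω := by
  have hX := hσ.aemeasurable_comp hτ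
  have hlim : Tendsto (fun n : ℕ ↦ ∫ ω, Real.exp (-(n * σ (τ ω) ω)) ∂P) atTop (𝓝 0) := by
    simp_rw [hσ.integral_exp_comp hτ hc hexp hind (Nat.cast_nonneg _)]
    exact (tendsto_const_nhds.div_atTop (tendsto_atTop_add_const_left _ _
      ((tendsto_rpow_atTop hβ).comp tendsto_natCast_atTop_atTop)))
  have hlim2 : Tendsto (fun n : ℕ ↦ ∫ ω, Real.exp (-(n * σ (τ ω) ω)) ∂P) atTop
      (𝓝 (∫ ω, ({0} : Set ℝ).indicator (fun _ ↦ (1 : ℝ)) (σ (τ ω) ω) ∂P)) := by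
    refine tendsto_integral_of_dominated_convergence (fun _ ↦ 1) (fun n ↦ ?_)
      (integrable_const _) (fun n ↦ ?_) ?_
    · exact (Real.measurable_exp.comp_aemeasurable (hX.const_mul _).neg).aestronglyMeasurable
    · filter_upwards [hσ.ae_nonneg] with ω hω
      rw [Real.norm_of_nonneg (Real.exp_pos _).le, Real.exp_le_one_iff, neg_nonpos]
      exact mul_nonneg (Nat.cast_nonneg _) (hω _)
    · filter_upwards [hσ.ae_nonneg] with ω hω
      rcases (hω (τ ω)).eq_or_lt with h | h
      · simp [← h]
      · simp only [indicator, mem_singleton_iff, h.ne', if_false]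
        exact Real.tendsto_exp_atBot.comp (tendsto_neg_atTop_atBot.comp
          (tendsto_natCast_atTop_atTop.atTop_mul_const h))
  have h0 := tendsto_nhds_unique hlim2 hlim
  rw [integral_eq_zero_iff_of_nonneg] at h0
  · filter_upwards [h0, hσ.ae_nonneg] with ω h1 h2
    refine (h2 _).lt_of_ne fun h ↦ ?_
    simp [← h] at h1
  · exact fun ω ↦ indicator_nonneg (fun _ _ ↦ zero_le_one) _
  · refine (integrable_const (1 : ℝ)).mono' ?_ (Eventually.of_forall fun ω ↦ ?_)
    · exact ((measurable_const.indicator (measurableSet_singleton 0)).comp_aemeasurable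
        hX).aestronglyMeasurable
    · rw [Real.norm_of_nonneg (indicator_nonneg (fun _ _ ↦ zero_le_one) _)]
      exact indicator_le_self' (fun _ _ ↦ zero_le_one) _

end Subordinator

/-! ### Assembly of the main theorem -/

lemma sq_rpow_half (α : ℝ) (n : ℤ) : ((n : ℝ) ^ 2) ^ (α / 2) = |(n : ℝ)| ^ α := by
  rw [← sq_abs, ← Real.rpow_natCast, ← Real.rpow_mul (abs_nonneg _)]
  congr 1; push_cast; ring

theorem mainTheorem2 (α c : ℝ) (hα : α ∈ Set.Ioc (0 : ℝ) 2) (hc : 0 < c) :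
    (∀ x ∈ Set.Ioo 0 Real.pi,
      Summable (greenTerm α c x) (SummationFilter.symmetricIcc ℤ)) ∧
    (∀ (Ω : Type*) [MeasurableSpace Ω] (P : Measure Ω) [IsProbabilityMeasure P]
        (σ : ℝ≥0 → Ω → ℝ) (τ : Ω → ℝ≥0),
      IsStableSubordinator (α / 2) σ P →
      Measurable τ →
      P.map (fun ω ↦ (τ ω : ℝ)) = expMeasure c →
      IndepFun τ (fun ω t ↦ σ t ω) P →
      ∀ x ∈ Set.Ioo 0 Real.pi,
        (∀ᵐ ω ∂P, Multipliable (jacobiFactor x (σ (τ ω) ω))) ∧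
        Integrable (fun ω ↦ jacobiProduct x (σ (τ ω) ω)) P ∧
        greenG α c x =
          1 / (2 * Real.pi * c) * ∫ ω, jacobiProduct x (σ (τ ω) ω) ∂P) ∧
    (∀ x ∈ Set.Ioo 0 Real.pi, 0 < greenG α c x) ∧
    StrictAntiOn (greenG α c) (Set.Ioo 0 Real.pi) := by

  have hβ : α / 2 ∈ Ioc (0 : ℝ) 1 := ⟨by linarith [hα.1], by linarith [hα.2]⟩
  obtain ⟨μ, _, hμpos, hμlap⟩ := exists_measure_laplace hβ hc
  -- The total mass is `1 / c`; nonvanishing is what makes the integral inequalities strict.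
  have hμ0 : μ ≠ 0 := by
    rintro rfl
    have h := hμlap 0 le_rfl
    rw [integral_zero_measure, Real.zero_rpow hβ.1.ne', add_zero] at h
    exact (inv_pos.2 hc).ne h
  -- Here `K = 1`; for the probability measure `P` below, `K = c`.
  have hrep {x : ℝ} (hx : x ∈ Ioo 0 Real.pi) :=
    integrable_jacobiProduct_and_hasSum (X := Prod.snd) measurable_snd.aemeasurable hμpos
      one_ne_zero (α := α) (c := c) (fun n ↦ by
        rw [hμlap _ (sq_nonneg _), sq_rpow_half, one_div]) hx
  have hG {x : ℝ} (hx : x ∈ Ioo 0 Real.pi) :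
      greenG α c x = 1 / (2 * Real.pi) * ∫ p, jacobiProduct x p.2 ∂μ := by
    rw [greenG, (hrep hx).2.tsum_eq, inv_one, one_mul]
  have hπ := Real.pi_pos
  refine ⟨fun x hx ↦ (hrep hx).2.summable, ?_, fun x hx ↦ ?_, fun x hx y hy hxy ↦ ?_⟩
  · intro Ω _ P _ σ τ hσ hτ hexp hind x hx
    have hpos := hσ.ae_pos_comp hβ.1 hτ hc hexp hind
    obtain ⟨h1, h2⟩ := integrable_jacobiProduct_and_hasSum (hσ.aemeasurable_comp hτ) hpos hc.ne'
      (α := α) (c := c) (fun n ↦ by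
        rw [hσ.integral_exp_comp hτ hc hexp hind (sq_nonneg _), sq_rpow_half]) hx
    refine ⟨hpos.mono fun ω hω ↦ multipliable_jacobiFactor x hω, h1, ?_⟩
    rw [greenG, h2.tsum_eq, ← mul_assoc]
    congr 1
    field_simp
  · rw [hG hx]
    refine mul_pos (by positivity) ?_
    have := integral_lt_integral_of_ae_lt hμ0 (integrable_zero _ _ _) (hrep hx).1
      (hμpos.mono fun p hp ↦ jacobiProduct_pos x hp)
    simpa using this
  · rw [hG hx, hG hy]
    refine mul_lt_mul_of_pos_left ?_ (by positivity)
    refine integral_lt_integral_of_ae_lt hμ0 (hrep hy).1 (hrep hx).1 (hμpos.mono fun p hp ↦ ?_)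
    exact jacobiProduct_lt hp (Real.strictAntiOn_cos ⟨hx.1.le, hx.2.le⟩ ⟨hy.1.le, hy.2.le⟩ hxy)
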